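/- Let $q$ be a power of an odd prime, let $t\ge 3$ be an integer and $n=2t$ (so $n\ge 6$ is even), and let $k$ be a non-negative integer with $\gcd(n,k)=1$. Define $\psi_n\colon\mathbb F_{q^n}\to\mathbb F_{q^n}$ by $$\psi_n(x)=\tfrac12\bigl(x+x^{q^t}\bigr)^{q^{t-1}}+\tfrac12\bigl(x-x^{q^t}\bigr)^{q}=\tfrac12\bigl(x^q+x^{q^{t-1}}-x^{q^{t+1}}+x^{q^{2t-1}}\bigr),$$ let $\psi_n^{(k)}$ be the $k$-fold composition of $\psi_n$ with itself, and let $$L_{\psi_n^{(k)}}=\{\langle (x,\psi_n^{(k)}(x))\rangle_{\mathbb F_{q^n}} : x\in\mathbb F_{q^n}^*\}$$ be the associated $\mathbb F_q$-linear set of rank $n$ of the projective line $\mathrm{PG}(1,q^n)$. A set of points of $\mathrm{PG}(1,q^n)$ is called a linear set of pseudoregulus type if it is the image, under an element of $\mathrm{P\Gamma L}(2,q^n)$, of $\{\langle (x,x^{q^s})\rangle_{\mathbb F_{q^n}} : x\in\mathbb F_{q^n}^*\}$ for some integer $s$ with $1\le s\le n-1$ and $\gcd(s,n)=1$. Then $L_{\psi_n^{(k)}}$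 is not of pseudoregulus type. (This holds whether or not $L_{\psi_n^{(k)}}$ is scattered, so in particular whenever it is a maximum scattered linear set.) -/

import Mathlib

open scoped LinearAlgebra.Projectivization

/-- The `m`-fold Frobenius `x ↦ x ^ (q ^ m)` with `q = |F|`, as an `F`-linear endomorphism of an
extension field `K` of the finite field `F`. -/
noncomputable def frobPow (F K : Type*) [Field F] [Finite F] [Field K] [Algebra F K] (m : ℕ) : K →ₗ[F] K where
  toFun x := x ^ (Nat.card F ^ m)
  map_add' x y := by
    have := Fintype.ofFinite F
    have h := map_add (FiniteField.frobeniusAlgHom F K ^ m) x y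
    simpa [FiniteField.coe_frobeniusAlgHom, AlgHom.coe_pow, pow_iterate,
      Nat.card_eq_fintype_card] using h
  map_smul' c x := by
    have := Fintype.ofFinite F
    simp only [Algebra.smul_def, mul_pow, ← map_pow, Nat.card_eq_fintype_card,
      FiniteField.pow_card_pow, RingHom.id_apply]

/-- The `q`-polynomial `α(x) = (x + x ^ (q ^ t)) ^ (q ^ (t - 1)) / 2`; it is used for `t ≥ 3` and
`[K : F] = 2 * t`, where `x + x ^ (q ^ t)` is the trace of `x` over the subfield of order `q ^ t`. -/
noncomputable def alphaPoly (F K : Type*) [Field F] [Finite F] [Field K] [Algebra F K] (t : ℕ) :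
    K →ₗ[F] K :=
  (2 : F)⁻¹ • (frobPow F K (t - 1) ∘ₗ (LinearMap.id + frobPow F K t))

/-- The `q`-polynomial `β(x) = (x - x ^ (q ^ t)) ^ q / 2`. -/
noncomputable def betaPoly (F K : Type*) [Field F] [Finite F] [Field K] [Algebra F K] (t : ℕ) :
    K →ₗ[F] K :=
  (2 : F)⁻¹ • (frobPow F K 1 ∘ₗ (LinearMap.id - frobPow F K t))

/-- The `q`-polynomial `ψ = α + β`, regarded as a map `K → K`. -/
noncomputable def psiPoly (F K : Type*) [Field F] [Finite F] [Field K] [Algebra F K] (t : ℕ) :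
    Module.End F K :=
  alphaPoly F K t + betaPoly F K t

/-- The linear set `L_U` of the projective line `PG(1, K)` defined by an `F`-subspace `U` of `K²`:
the points spanned over `K` by the nonzero vectors of `U`. -/
def linearSet {F K : Type*} [Field F] [Field K] [Algebra F K] (U : Submodule F (K × K)) :
    Set (ℙ K (K × K)) :=
  {P | ∃ (u : K × K) (hu : u ≠ 0), u ∈ U ∧ P = Projectivization.mk K u hu}

/-- The linear set `L_f = {⟨(x, f x)⟩ : x ≠ 0}`. -/
def linearSetOf {F K : Type*} [Field F] [Field K] [Algebra F K] (f : K →ₗ[F] K) :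
    Set (ℙ K (K × K)) :=
  linearSet f.graph

/-- Equivalence of point sets of `PG(1, K)` under `PΓL(2, K)`, the group induced by the bijective
semilinear maps of `K²`. -/
def PGammaLEquivalent {K : Type*} [Field K] (L L' : Set (ℙ K (K × K))) : Prop :=
  ∃ (σ : K ≃+* K) (g : (K × K) →ₛₗ[(σ : K →+* K)] (K × K)) (hg : Function.Bijective g),
    Projectivization.map g hg.injective '' L = L'

/-- A set of points of `PG(1, K)`, `n = [K : F]`, is a linear set of pseudoregulus type if it is
`PΓL(2, K)`-equivalent to `{⟨(x, x ^ (q ^ s))⟩ : x ≠ 0}` for some `1 ≤ s ≤ n - 1` prime to `n`. -/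
def IsPseudoregulusType (F : Type*) {K : Type*} [Field F] [Finite F] [Field K] [Algebra F K]
    (L : Set (ℙ K (K × K))) : Prop :=
  ∃ s : ℕ, 1 ≤ s ∧ s ≤ Module.finrank F K - 1 ∧ Nat.gcd s (Module.finrank F K) = 1 ∧
    PGammaLEquivalent (linearSetOf (frobPow F K s)) L

theorem frobPow_apply {F K : Type*} [Field F] [Finite F] [Field K] [Algebra F K] (m : ℕ) (x : K) :
    frobPow F K m x = x ^ (Nat.card F ^ m) := rfl

/-!
Write `σ` for the Frobenius map `x ↦ x ^ q` of `K` over `F`, so that every `F`-linear map `K → K`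
is uniquely `∑ j, a j • σ ^ j` with `j` modulo `n`.

Suppose `L_f` is of pseudoregulus type. Up to a change of coordinates `f` becomes an `F`-linear map
`g` whose slopes `g x / x` are exactly those of some `σ ^ s` with `s` prime to `n`. Any sum
`∑ φ (g x / x)` over `x ≠ 0` depends only on the set of slopes, as each slope is taken `-1` times
modulo the characteristic (`sum_slopes_eq_of_range_eq`). Power sums with exponent
`q ^ w₁ + ⋯ + q ^ wᵣ`, the `wᵢ` distinct, are combinatorial: they expand into a sum over the maps
`w ↦ m` that permute the set of the `wᵢ`, with term `- ∏ (a (mᵢ - wᵢ)) ^ (q ^ wᵢ)`; here `q ≥ 3`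
ensures that no carries occur modulo `q ^ n - 1` (`mem_range_of_sum_pow_modEq`). If the `wᵢ` are the
vertices of a shortest cycle in the Cayley digraph of the exponents of `g`
(`exists_chordless_cycle`), then a single term is nonzero. Comparison with the power sum of
`σ ^ s` shows that the vertex set is invariant under translation by `s`, hence is all of `ZMod n`;
a chordless cycle through all vertices means that `g = c • σ ^ i` for one `i`, of order `n`
(`exists_eq_mul_frobMod_of_slopes`).

So `p₁ f - p₂ = c σ ^ i (q₂ - q₁ f)` with `p₁ q₂ ≠ p₂ q₁` (`exists_monomial_relation`). If `f`
has no constant term, comparing coefficients shows that the support of `f` consists of all nonzero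
exponents or of at most one exponent (`coeff_eq_zero_of_monomial_relation`). But
`ψ ^ k = (σ ^ (-k) (1 + σ ^ t) + σ ^ k (1 - σ ^ t)) / 2` (`psiPoly_pow_apply`) is nonzero, its four
exponents `± k`, `t ± k` are distinct and nonzero, and they are permuted by translation by `t`.
-/

/-! ### Digits modulo `q ^ n - 1` -/

theorem pow_modEq_pow_zmod_val (q n a : ℕ) (hq : 1 ≤ q) :
    q ^ ((a : ZMod n).val) ≡ q ^ a [MOD q ^ n - 1] := by
  have h1 : q ^ n ≡ 1 [MOD q ^ n - 1] :=
    ((Nat.modEq_iff_dvd' (Nat.one_le_pow _ _ hq)).2 dvd_rfl).symm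
  rw [ZMod.val_natCast]
  conv_rhs => rw [← Nat.mod_add_div a n, pow_add, pow_mul]
  simpa using (h1.symm.pow (a / n)).mul_left (q ^ (a % n))

/-- The number with base-`q` digits `c`, the digit positions being taken modulo `n`. -/
def digitValue (q : ℕ) {n : ℕ} [NeZero n] (c : ZMod n → ℕ) : ℕ :=
  ∑ j, c j * q ^ j.val

theorem exists_fin_digits (q n : ℕ) [NeZero n] (c : ZMod n → ℕ) (hc : ∀ j, c j < q) :
    ∃ f : Fin n → Fin q, (∀ j : ZMod n, ((f ⟨j.val, j.val_lt⟩ : Fin q) : ℕ) = c j) ∧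
      digitValue q c = (finFunctionFinEquiv f : ℕ) := by
  obtain _ | n := n
  · exact absurd rfl (NeZero.ne 0)
  · refine ⟨fun j => ⟨c (j : Fin (n + 1)), hc _⟩, fun j => rfl, ?_⟩
    rw [finFunctionFinEquiv_apply]
    rfl

theorem digitValue_lt {q n : ℕ} [NeZero n] {c : ZMod n → ℕ} (hc : ∀ j, c j < q) :
    digitValue q c < q ^ n := by
  obtain ⟨f, -, hf⟩ := exists_fin_digits q n c hc
  rw [hf]
  exact (finFunctionFinEquiv f).isLt

theorem digitValue_injOn {q n : ℕ} [NeZero n] {c d : ZMod n → ℕ} (hc : ∀ j, c j < q)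
    (hd : ∀ j, d j < q) (h : digitValue q c = digitValue q d) : c = d := by
  obtain ⟨f, hf, hf'⟩ := exists_fin_digits q n c hc
  obtain ⟨g, hg, hg'⟩ := exists_fin_digits q n d hd
  have : f = g := finFunctionFinEquiv.injective (Fin.ext (by rw [← hf', ← hg', h]))
  funext j
  rw [← hf, ← hg, this]

/-- Carrying (cyclically) brings every digit below `q`, and each carry lowers the digit sum. -/
theorem exists_reduced_digits {q n : ℕ} [NeZero n] (hq : 2 ≤ q) (c : ZMod n → ℕ) :
    ∃ c' : ZMod n → ℕ, (∀ j, c' j < q) ∧ digitValue q c' ≡ digitValue q c [MOD q ^ n - 1] ∧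
      (c' = c ∨ ∑ j, c' j < ∑ j, c j) := by
  induction hN : ∑ j, c j using Nat.strong_induction_on generalizing c with
  | _ N ih =>
    by_cases h : ∀ j, c j < q
    · exact ⟨c, h, rfl, Or.inl rfl⟩
    · push Not at h
      obtain ⟨j, hj⟩ := h
      -- Carry `q` units of digit `j` to one unit of digit `j + 1`.
      let d : ZMod n → ℕ := Function.update c j (c j - q) + Pi.single (j + 1) 1
      have key : ∀ w : ZMod n → ℕ, ∑ i, d i * w i + q * w j = ∑ i, c i * w i + w (j + 1) := by
        intro w
        have h1 : ∑ i, d i * w i = ∑ i, Function.update c j (c j - q) i * w i + w (j + 1) := by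
          simp only [d, Pi.add_apply, add_mul, Finset.sum_add_distrib]
          congr 1
          simp [Pi.single_apply]
        have h2 : ∀ i, Function.update c j (c j - q) i * w i + (if i = j then q * w j else 0)
            = c i * w i := by
          intro i
          by_cases hi : i = j
          · subst hi
            simp [← add_mul, Nat.sub_add_cancel hj]
          · simp [hi]
        have h3 := Finset.sum_congr rfl (fun i (_ : i ∈ Finset.univ) => h2 i)
        rw [Finset.sum_add_distrib, Finset.sum_ite_eq' Finset.univ j] at h3
        simp only [Finset.mem_univ, if_true] at h3
        rw [h1, ← h3]
        ring
      have hs := key (fun _ => 1)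
      simp only [mul_one] at hs
      have hlt : ∑ i, d i < N := by omega
      obtain ⟨c', hc1, hc2, hc3⟩ := ih _ hlt d rfl
      refine ⟨c', hc1, hc2.trans ?_, Or.inr ?_⟩
      · have hv := key (fun i => q ^ i.val)
        refine Nat.ModEq.add_right_cancel' (q * q ^ j.val) ?_
        unfold digitValue
        rw [hv]
        refine Nat.ModEq.add_left _ ?_
        have := pow_modEq_pow_zmod_val q n (j.val + 1) (by omega)
        rw [Nat.cast_add, ZMod.natCast_zmod_val, Nat.cast_one, pow_succ'] at this
        exact this
      · rcases hc3 with rfl | h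
        · exact hlt
        · exact h.trans hlt

/-- If `r` powers of `q` add up, modulo `q ^ n - 1`, to a sum of `r` distinct powers `q ^ j`,
`j < n`, then they are these powers: no carry can occur, as it would lower the digit sum. -/
theorem mem_range_of_sum_pow_modEq {q n : ℕ} [NeZero n] (hq : 3 ≤ q) {ι : Type*} [Fintype ι]
    (m w : ι → ZMod n) (hw : Function.Injective w)
    (h : ∑ i, q ^ (m i).val ≡ ∑ i, q ^ (w i).val [MOD q ^ n - 1]) (i : ι) :
    m i ∈ Set.range w := by
  classical
  have hcount : ∀ (v : ι → ZMod n) (φ : ZMod n → ℕ),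
      ∑ j, (Finset.univ.filter (fun i => v i = j)).card * φ j = ∑ i, φ (v i) := by
    intro v φ
    rw [← Finset.sum_fiberwise_of_maps_to (g := v) (t := Finset.univ) (by simp)]
    refine Finset.sum_congr rfl fun j _ => ?_
    rw [Finset.sum_congr rfl (g := fun _ => φ j) (by intro i hi; simp at hi; rw [hi])]
    simp
  let c : ZMod n → ℕ := fun j => (Finset.univ.filter (fun i => m i = j)).card
  let d : ZMod n → ℕ := fun j => (Finset.univ.filter (fun i => w i = j)).card
  have hd : ∀ j, d j ≤ 1 := by
    intro j
    refine Finset.card_le_one.2 ?_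
    intro a ha b hb
    simp at ha hb
    exact hw (ha.trans hb.symm)
  have hcd : digitValue q c ≡ digitValue q d [MOD q ^ n - 1] := by
    unfold digitValue
    rw [hcount m (fun j => q ^ j.val), hcount w (fun j => q ^ j.val)]
    exact h
  have hsum : ∑ j, c j = ∑ j, d j := by
    have h1 := hcount m (fun _ => 1)
    have h2 := hcount w (fun _ => 1)
    simp only [mul_one] at h1 h2
    exact h1.trans h2.symm
  obtain ⟨c', hc1, hc2, hc3⟩ := exists_reduced_digits (by omega : 2 ≤ q) c
  have hpos : 0 < digitValue q d := by
    have hdi : 0 < d (w i) := Finset.card_pos.2 ⟨i, by simp⟩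
    refine lt_of_lt_of_le ?_
      (Finset.single_le_sum (f := fun j => d j * q ^ j.val) (by simp) (Finset.mem_univ (w i)))
    positivity
  -- Doubling the digits `0, 1` of `d` still gives digits below `q`, hence `2 * d < q ^ n`.
  have hlt : digitValue q d < q ^ n - 1 := by
    have h2 : digitValue q (fun j => 2 * d j) < q ^ n :=
      digitValue_lt fun j => by have := hd j; omega
    have h3 : digitValue q (fun j => 2 * d j) = 2 * digitValue q d := by
      simp only [digitValue, Finset.mul_sum, mul_assoc]
    omega
  have hval : digitValue q c' = digitValue q d := by
    have hc'lt := digitValue_lt hc1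
    have hmod : digitValue q c' ≡ digitValue q d [MOD q ^ n - 1] := hc2.trans hcd
    rcases Nat.lt_or_ge (digitValue q c') (q ^ n - 1) with hl | hl
    · exact hmod.eq_of_lt_of_lt hl hlt
    · have he : digitValue q c' = q ^ n - 1 := by omega
      rw [he] at hmod
      have h0 : (q ^ n - 1) ≡ 0 [MOD q ^ n - 1] := by simp [Nat.ModEq]
      have := (h0.symm.trans hmod).eq_of_lt_of_lt (by omega) hlt
      omega
  have hc'd : c' = d := digitValue_injOn hc1 (fun j => by have := hd j; omega) hval
  rcases hc3 with h' | h'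
  · have h1 : 0 < d (m i) := by
      rw [← hc'd, h']
      exact Finset.card_pos.2 ⟨i, by simp⟩
    obtain ⟨k, hk⟩ := Finset.card_pos.1 h1
    exact ⟨k, by simpa using hk⟩
  · rw [hc'd] at h'
    omega

/-! ### Shortest zero-sum sequences -/

/-- A shortest nonempty zero-sum sequence in `A` has partial sums `w` forming a shortest cycle of
the Cayley digraph of `A`; such a cycle is chordless, and no element of `A` has order below its
length. -/
theorem exists_chordless_cycle {G : Type*} [AddCommGroup G] [Finite G] {A : Set G}
    (hA : A.Nonempty) :
    ∃ (r : ℕ) (w : ℕ → G), 0 < r ∧ w 0 = 0 ∧ w r = 0 ∧ (∀ i < r, w (i + 1) - w i ∈ A) ∧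
      (∀ i < r, ∀ j < r, w i = w j → i = j) ∧
      (∀ i < r, ∀ j < r, w j - w i ∈ A → w j = w (i + 1)) ∧
      (∀ a ∈ A, ∀ l, 0 < l → l • a = 0 → r ≤ l) := by
  classical
  -- `S l x`: there is a walk of length `l` with total displacement `x`.
  let S : ℕ → G → Prop := fun l x =>
    ∃ s : Multiset G, Multiset.card s = l ∧ (∀ a ∈ s, a ∈ A) ∧ s.sum = x
  have hadd : ∀ {l l' x x'}, S l x → S l' x' → S (l + l') (x + x') := by
    rintro l l' x x' ⟨s, rfl, hs, rfl⟩ ⟨s', rfl, hs', rfl⟩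
    refine ⟨s + s', by simp, ?_, by simp⟩
    intro a ha
    rcases Multiset.mem_add.1 ha with h | h
    exacts [hs a h, hs' a h]
  have hone : ∀ {a}, a ∈ A → S 1 a := fun {a} ha => ⟨{a}, by simp, by simpa using ha, by simp⟩
  have hsmul : ∀ {a}, a ∈ A → ∀ l, S l (l • a) := fun {a} ha l =>
    ⟨Multiset.replicate l a, by simp, fun b hb => (Multiset.eq_of_mem_replicate hb) ▸ ha, by simp⟩
  have hex : ∃ l, 0 < l ∧ S l 0 := by
    obtain ⟨a, ha⟩ := hA
    refine ⟨addOrderOf a, addOrderOf_pos a, ?_⟩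
    have := hsmul ha (addOrderOf a)
    rwa [addOrderOf_nsmul_eq_zero] at this
  let r := Nat.find hex
  obtain ⟨hr, s, hs, hsA, hs0⟩ := Nat.find_spec hex
  have hmin : ∀ l, 0 < l → S l 0 → r ≤ l := fun l h1 h2 => Nat.find_min' hex ⟨h1, h2⟩
  change Multiset.card s = r at hs
  change 0 < r at hr
  let w : ℕ → G := fun i => (s.toList.take i).sum
  have hlen : s.toList.length = r := by simpa using hs
  have hw0 : w 0 = 0 := by simp [w]
  have hwr : w r = 0 := by
    simp only [w]
    rw [List.take_of_length_le hlen.le, Multiset.sum_toList, hs0]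
  have hstep : ∀ i < r, w (i + 1) - w i ∈ A := by
    intro i hi
    simp only [w]
    rw [List.sum_take_succ _ _ (hlen ▸ hi), add_sub_cancel_left]
    exact hsA _ (Multiset.mem_toList.1 (List.getElem_mem _))
  have hseg : ∀ i l, i + l ≤ r → S l (w (i + l) - w i) := by
    intro i l
    induction l with
    | zero => exact fun _ => ⟨0, by simp, by simp, by simp⟩
    | succ l ih =>
      intro h
      have := hadd (ih (by omega)) (hone (hstep (i + l) (by omega)))
      rwa [add_comm (w (i + l) - w i), sub_add_sub_cancel] at this
  refine ⟨r, w, hr, hw0, hwr, hstep, ?_, ?_, fun a ha l hl h0 => hmin l hl (h0 ▸ hsmul ha l)⟩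
  · have aux : ∀ i j, i < j → j < r → w i ≠ w j := by
      intro i j hij hj he
      have h := hseg i (j - i) (by omega)
      rw [show i + (j - i) = j by omega, he, sub_self] at h
      have := hmin _ (by omega) h
      omega
    intro i hi j hj he
    rcases lt_trichotomy i j with h | h | h
    · exact absurd he (aux i j h hj)
    · exact h
    · exact absurd he.symm (aux j i h hi)
  · intro i hi j hj ha
    rcases Nat.lt_or_ge i j with h | h
    · -- The chord replaces the arc from `i` to `j`.
      have h1 := hadd (hseg 0 i (by omega)) (hadd (hone ha) (hseg j (r - j) (by omega)))
      rw [show j + (r - j) = r by omega, hwr, zero_add, hw0,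
        show w i - 0 + (w j - w i + (0 - w j)) = 0 by abel] at h1
      have := hmin _ (by omega) h1
      rw [show j = i + 1 by omega]
    · -- The chord closes the arc from `j` to `i`.
      have h1 := hadd (hseg j (i - j) (by omega)) (hone ha)
      rw [show j + (i - j) = i by omega, sub_add_sub_cancel, sub_self] at h1
      have := hmin _ (by omega) h1
      rw [show j = 0 by omega, show i + 1 = r by omega, hw0, hwr]

/-! ### Expansions in powers of the Frobenius map -/

/-- The power `x ↦ x ^ (q ^ j)` of the Frobenius map, with `j` an exponent modulo `n = [K : F]`. -/
noncomputable def frobMod (F K : Type*) [Field F] [Finite F] [Field K] [Algebra F K] {n : ℕ}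
    (j : ZMod n) : K →ₗ[F] K :=
  frobPow F K j.val

section Frobenius

variable {F K : Type*} [Field F] [Finite F] [Field K] [Algebra F K] {n : ℕ}

theorem frobMod_apply (j : ZMod n) (x : K) : frobMod F K j x = x ^ Nat.card F ^ j.val := rfl

theorem frobMod_mul (j : ZMod n) (x y : K) :
    frobMod F K j (x * y) = frobMod F K j x * frobMod F K j y := by
  simp only [frobMod_apply, mul_pow]

theorem frobMod_eq_zero (j : ZMod n) {x : K} : frobMod F K j x = 0 ↔ x = 0 := by
  rw [frobMod_apply, pow_eq_zero_iff (pow_ne_zero _ Nat.card_pos.ne')]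

variable [NeZero n]

theorem finite_of_finrank (hK : Module.finrank F K = n) : Finite K := by
  have : FiniteDimensional F K := FiniteDimensional.of_finrank_pos (hK ▸ Nat.pos_of_neZero n)
  exact Module.finite_of_finite F

omit [Finite F] in
theorem natCard_eq_pow (hK : Module.finrank F K = n) : Nat.card K = Nat.card F ^ n := by
  have : FiniteDimensional F K := FiniteDimensional.of_finrank_pos (hK ▸ Nat.pos_of_neZero n)
  rw [← hK]
  exact Module.natCard_eq_pow_finrank

theorem frobMod_natCast (hK : Module.finrank F K = n) (a : ℕ) (x : K) :
    frobMod F K (a : ZMod n) x = x ^ Nat.card F ^ a := by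
  rw [frobMod_apply]
  rcases eq_or_ne x 0 with rfl | hx
  · rw [zero_pow (pow_ne_zero _ Nat.card_pos.ne'), zero_pow (pow_ne_zero _ Nat.card_pos.ne')]
  · have := finite_of_finrank hK
    have h1 : (Units.mk0 x hx) ^ (Nat.card F ^ n - 1) = 1 := by
      rw [← natCard_eq_pow hK, ← Nat.card_units, pow_card_eq_one']
    have h2 := pow_eq_pow_of_modEq
      (pow_modEq_pow_zmod_val (Nat.card F) n a Nat.card_pos) h1
    simpa using congrArg Units.val h2

theorem frobMod_add (hK : Module.finrank F K = n) (i j : ZMod n) (x : K) :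
    frobMod F K (i + j) x = frobMod F K i (frobMod F K j x) := by
  have h : i + j = ((j.val + i.val : ℕ) : ZMod n) := by
    rw [Nat.cast_add, ZMod.natCast_zmod_val, ZMod.natCast_zmod_val, add_comm]
  rw [h, frobMod_natCast hK, frobMod_apply, frobMod_apply, ← pow_mul, ← pow_add]

omit [NeZero n] in
theorem frobMod_zero (x : K) : frobMod F K (0 : ZMod n) x = x := by
  simp [frobMod_apply]

/-- Dedekind independence of the Frobenius powers. -/
theorem linearIndependent_frobMod (hK : Module.finrank F K = n) :
    LinearIndependent K (fun j : ZMod n => frobMod F K j) := by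
  have := Fintype.ofFinite F
  have := finite_of_finrank hK
  have h := (linearIndependent_algHom_toLinearMap F K K).comp
    (fun j : ZMod n => FiniteField.frobeniusAlgHom F K ^ j.val) ?_
  · have heq : (AlgHom.toLinearMap ∘ fun j : ZMod n => FiniteField.frobeniusAlgHom F K ^ j.val) =
        fun j : ZMod n => frobMod F K j := by
      funext j
      ext x
      simp [frobMod_apply, FiniteField.coe_frobeniusAlgHom, AlgHom.coe_pow, pow_iterate,
        Nat.card_eq_fintype_card]
    rw [heq] at h
    exact h
  · intro i j hij
    have := (FiniteField.bijective_frobeniusAlgHom_pow F K).1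
      (a₁ := ⟨i.val, hK ▸ i.val_lt⟩) (a₂ := ⟨j.val, hK ▸ j.val_lt⟩) hij
    exact ZMod.val_injective n (by simpa using this)

theorem eq_of_frobMod_expansion (hK : Module.finrank F K = n) {a b : ZMod n → K}
    (h : ∀ x : K, ∑ j, a j * frobMod F K j x = ∑ j, b j * frobMod F K j x) : a = b := by
  funext j
  have h0 : ∑ j, (a j - b j) • frobMod F K j = 0 := by
    ext x
    simp [sub_mul, Finset.sum_sub_distrib, h x]
  have hli := linearIndependent_frobMod (F := F) hK
  rw [Fintype.linearIndependent_iff] at hli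
  exact sub_eq_zero.1 (hli (fun j => a j - b j) h0 j)

theorem exists_frobMod_expansion (hK : Module.finrank F K = n) (g : K →ₗ[F] K) :
    ∃ a : ZMod n → K, ∀ x, g x = ∑ j, a j * frobMod F K j x := by
  have : FiniteDimensional F K := FiniteDimensional.of_finrank_pos (hK ▸ Nat.pos_of_neZero n)
  have h := (linearIndependent_frobMod hK).span_eq_top_of_card_eq_finrank' (by
    rw [ZMod.card, Module.finrank_linearMap_self, hK])
  obtain ⟨c, hc⟩ := (Submodule.mem_span_range_iff_exists_fun K).1
    (show g ∈ Submodule.span K (Set.range fun j : ZMod n => frobMod F K j) by rw [h]; trivial)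
  refine ⟨c, fun x => ?_⟩
  rw [← hc]
  simp

end Frobenius

/-! ### Power sums of slopes -/

section PowerSums

variable {F K : Type*} [Field F] [Finite F] [Field K] [Algebra F K]

/-- A sum over the slopes `g x / x` depends only on the set of slopes: the slope `y` is taken
`q ^ w - 1` times, where `w` is the dimension of the kernel of `x ↦ g x - y x`, hence `-1` times
in `K`. -/
theorem sum_slopes_eq_of_range_eq [Finite K] [Fintype Kˣ] {g h : K →ₗ[F] K}
    (hgh : Set.range (fun u : Kˣ => g u * (u : K)⁻¹) = Set.range fun u : Kˣ => h u * (u : K)⁻¹)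
    (φ : K → K) :
    ∑ u : Kˣ, φ (g u * (u : K)⁻¹) = ∑ u : Kˣ, φ (h u * (u : K)⁻¹) := by
  classical
  have := Fintype.ofFinite F
  have hqK : (Nat.card F : K) = 0 := by
    have : (Fintype.card F : F) = 0 := Nat.cast_card_eq_zero F
    rw [Nat.card_eq_fintype_card, ← map_natCast (algebraMap F K), this, map_zero]
  have key : ∀ f : K →ₗ[F] K, ∑ u : Kˣ, φ (f u * (u : K)⁻¹) =
      ∑ y ∈ Finset.univ.image (fun u : Kˣ => f u * (u : K)⁻¹), -φ y := by
    intro f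
    rw [Finset.sum_comp φ (fun u : Kˣ => f u * (u : K)⁻¹)]
    refine Finset.sum_congr rfl fun y hy => ?_
    obtain ⟨u₀, -, hu₀⟩ := Finset.mem_image.1 hy
    let V : Submodule F K := LinearMap.ker (f - LinearMap.mulLeft F y)
    have hV : ∀ x, x ∈ V ↔ f x = y * x := fun x => by
      simp [V, LinearMap.mem_ker, sub_eq_zero]
    -- The fibre over `y`, together with `0`, is the kernel `V` of `f - y`.
    have hcard : (Finset.univ.filter (fun u : Kˣ => f u * (u : K)⁻¹ = y)).card + 1
        = Nat.card V := by
      have e : Option {u : Kˣ // f u * (u : K)⁻¹ = y} ≃ V :=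
        Equiv.ofBijective (fun o => o.elim 0 fun u => ⟨(u.1 : K),
          (hV _).2 ((mul_inv_eq_iff_eq_mul₀ u.1.ne_zero).1 u.2)⟩) (by
          constructor
          · rintro (_ | ⟨u, hu⟩) (_ | ⟨v, hv⟩) h
            · rfl
            · exact absurd (congrArg Subtype.val h).symm v.ne_zero
            · exact absurd (congrArg Subtype.val h) u.ne_zero
            · have : u = v := Units.ext (congrArg Subtype.val h)
              subst this
              rfl
          · rintro ⟨x, hx⟩
            by_cases h0 : x = 0
            · exact ⟨none, Subtype.ext h0.symm⟩
            · refine ⟨some ⟨Units.mk0 x h0, ?_⟩, rfl⟩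
              rw [Units.val_mk0, (hV x).1 hx, mul_inv_cancel_right₀ h0])
      rw [← Nat.card_congr e, Finite.card_option, Nat.card_eq_fintype_card, Fintype.card_subtype]
    have hzero : ((Nat.card V : ℕ) : K) = 0 := by
      rw [Module.natCard_eq_pow_finrank (K := F) (V := V), Nat.cast_pow, hqK, zero_pow]
      have : Nontrivial V := ⟨⟨⟨(u₀ : K),
        (hV _).2 ((mul_inv_eq_iff_eq_mul₀ u₀.ne_zero).1 hu₀)⟩, 0, fun h =>
          u₀.ne_zero (congrArg Subtype.val h)⟩⟩
      exact Module.finrank_pos.ne'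
    have : ((Finset.univ.filter (fun u : Kˣ => f u * (u : K)⁻¹ = y)).card : K) = -1 := by
      rw [← hcard, Nat.cast_add, Nat.cast_one] at hzero
      exact eq_neg_of_add_eq_zero_left hzero
    rw [nsmul_eq_mul, this, neg_one_mul]
  rw [key g, key h]
  refine Finset.sum_congr (Finset.coe_injective ?_) fun _ _ => rfl
  simpa using hgh

variable {n : ℕ} [NeZero n]

theorem sum_units_prod_frobMod (hK : Module.finrank F K = n) [Fintype Kˣ] {ι : Type*} [Fintype ι]
    (m w : ι → ZMod n)
    [Decidable (∑ i, Nat.card F ^ (m i).val ≡ ∑ i, Nat.card F ^ (w i).val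
      [MOD Nat.card F ^ n - 1])] :
    ∑ u : Kˣ, (∏ i, frobMod F K (m i) u) * ∏ i, frobMod F K (w i) ((u : K)⁻¹) =
      if ∑ i, Nat.card F ^ (m i).val ≡ ∑ i, Nat.card F ^ (w i).val [MOD Nat.card F ^ n - 1]
      then -1 else 0 := by
  classical
  have := finite_of_finrank hK
  have := Fintype.ofFinite K
  set M := ∑ i, Nat.card F ^ (m i).val
  set W := ∑ i, Nat.card F ^ (w i).val
  -- The summand is a character of the cyclic group `Kˣ`, trivial iff `u ^ M = u ^ W` for all `u`.
  let φ : Kˣ →* K := (Units.coeHom K).comp (powMonoidHom M * (powMonoidHom W)⁻¹)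
  have hφ : ∀ u : Kˣ, (∏ i, frobMod F K (m i) u) * ∏ i, frobMod F K (w i) ((u : K)⁻¹) = φ u := by
    intro u
    simp [φ, frobMod_apply, Finset.prod_pow_eq_pow_sum, M, W]
  rw [Finset.sum_congr rfl fun u _ => hφ u, sum_hom_units φ]
  have hiff : φ = 1 ↔ M ≡ W [MOD Nat.card F ^ n - 1] := by
    obtain ⟨v, hv⟩ := IsCyclic.exists_monoid_generator (α := Kˣ)
    have hord : orderOf v = Nat.card F ^ n - 1 := by
      rw [← natCard_eq_pow hK, ← Nat.card_units]
      exact orderOf_eq_card_of_forall_mem_powers hv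
    have h1 : ∀ u : Kˣ, φ u = 1 ↔ u ^ M = u ^ W := by
      intro u
      have : φ u = ((u ^ M * (u ^ W)⁻¹ : Kˣ) : K) := rfl
      rw [this, Units.val_eq_one, mul_inv_eq_one]
    rw [← hord, ← pow_eq_pow_iff_modEq, ← h1]
    refine ⟨fun h => by rw [h]; rfl, fun h => MonoidHom.ext fun u => ?_⟩
    obtain ⟨k, rfl⟩ := hv u
    simp [map_pow, h]
  have hcard : ((Fintype.card Kˣ : ℕ) : K) = -1 := by
    rw [← Nat.card_eq_fintype_card, Nat.card_units, Nat.card_eq_fintype_card,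
      Nat.cast_sub Fintype.card_pos, Nat.cast_card_eq_zero]
    simp
  simp only [hiff]
  split_ifs
  · exact hcard
  · simp

/-- The power sum of the slopes of `g = ∑ a j • σ ^ j` with exponent `∑ i, q ^ (w i)`. -/
theorem sum_slopes_prod_frobMod (hK : Module.finrank F K = n) [Fintype Kˣ] {ι : Type*} [Fintype ι]
    [DecidableEq ι] {g : K →ₗ[F] K} {a : ZMod n → K} (hg : ∀ x, g x = ∑ j, a j * frobMod F K j x)
    (w : ι → ZMod n)
    [DecidablePred fun m : ι → ZMod n => ∑ i, Nat.card F ^ (m i).val ≡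
      ∑ i, Nat.card F ^ (w i).val [MOD Nat.card F ^ n - 1]] :
    ∑ u : Kˣ, ∏ i, frobMod F K (w i) (g u * (u : K)⁻¹) =
      ∑ m : ι → ZMod n, (∏ i, frobMod F K (w i) (a (m i - w i))) *
        if ∑ i, Nat.card F ^ (m i).val ≡ ∑ i, Nat.card F ^ (w i).val [MOD Nat.card F ^ n - 1]
        then -1 else 0 := by
  have hexp : ∀ (i : ι) (x : K), frobMod F K (w i) (g x) =
      ∑ m, frobMod F K (w i) (a (m - w i)) * frobMod F K m x := by
    intro i x
    rw [hg, map_sum, ← Equiv.sum_comp (Equiv.subRight (w i))]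
    refine Finset.sum_congr rfl fun m _ => ?_
    rw [frobMod_mul, ← frobMod_add hK, Equiv.subRight_apply, add_sub_cancel]
  calc ∑ u : Kˣ, ∏ i, frobMod F K (w i) (g u * (u : K)⁻¹)
      = ∑ u : Kˣ, ∑ m : ι → ZMod n, (∏ i, frobMod F K (w i) (a (m i - w i))) *
          ((∏ i, frobMod F K (m i) u) * ∏ i, frobMod F K (w i) ((u : K)⁻¹)) := by
        refine Finset.sum_congr rfl fun u _ => ?_
        simp only [frobMod_mul, Finset.prod_mul_distrib, hexp]
        rw [Finset.prod_univ_sum, Fintype.piFinset_univ, Finset.sum_mul]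
        simp only [Finset.prod_mul_distrib, mul_assoc]
    _ = _ := by
        rw [Finset.sum_comm]
        refine Finset.sum_congr rfl fun m _ => ?_
        rw [← Finset.mul_sum, sum_units_prod_frobMod hK m w]

/-- An `F`-linear map with the slopes of a generator `x ↦ x ^ (q ^ s)` of the Galois group is a
multiple of such a generator. If `w` runs through a shortest cycle of the Cayley digraph of the
exponents of `g`, a single term survives in the power sum with exponent `∑ q ^ (w i)`; so the power
sum for `x ^ (q ^ s)` is nonzero too, which makes the cycle invariant under translation by `s`.
Hence the cycle is the whole of `ZMod n`, and being chordless it leaves room for one exponent. -/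
theorem exists_eq_mul_frobMod_of_slopes (hK : Module.finrank F K = n) (hq : 3 ≤ Nat.card F)
    {s : ZMod n} (hs : ∀ j : ZMod n, ∃ l : ℕ, j = l • s) {g : K →ₗ[F] K}
    (hgs : Set.range (fun u : Kˣ => g u * (u : K)⁻¹) =
      Set.range fun u : Kˣ => frobMod F K s u * (u : K)⁻¹) :
    ∃ (i : ZMod n) (c : K), c ≠ 0 ∧ (∀ l, 0 < l → l • i = 0 → n ≤ l) ∧
      ∀ x, g x = c * frobMod F K i x := by
  classical
  have := finite_of_finrank hK
  have := Fintype.ofFinite K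
  obtain ⟨a, ha⟩ := exists_frobMod_expansion hK g
  have hA : {j | a j ≠ 0}.Nonempty := by
    by_contra hne
    have ha0 : ∀ j, a j = 0 := by
      intro j
      by_contra hj
      exact hne ⟨j, hj⟩
    obtain ⟨u, hu⟩ : frobMod F K s ((1 : Kˣ) : K) * (((1 : Kˣ) : K))⁻¹ ∈
        Set.range (fun u : Kˣ => g u * (u : K)⁻¹) := hgs ▸ ⟨1, rfl⟩
    simp [ha, ha0, frobMod_apply] at hu
  obtain ⟨r, w, hr, hw0, hwr, hstep, hinj, hchord, hmin⟩ := exists_chordless_cycle hA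
  let v : Fin r → ZMod n := fun i => w i
  have hv : Function.Injective v := fun i j h => Fin.ext (hinj i i.2 j j.2 h)
  let v' : Fin r → ZMod n := fun i => w (i + 1)
  have hshift : ∑ i, Nat.card F ^ (v' i).val = ∑ i, Nat.card F ^ (v i).val := by
    simp only [v, v']
    rw [Fin.sum_univ_eq_sum_range (fun i => Nat.card F ^ (w (i + 1)).val) r,
      Fin.sum_univ_eq_sum_range (fun i => Nat.card F ^ (w i).val) r]
    have h1 := Finset.sum_range_succ (fun i => Nat.card F ^ (w i).val) r
    have h2 := Finset.sum_range_succ' (fun i => Nat.card F ^ (w i).val) r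
    rw [hwr] at h1
    rw [hw0] at h2
    omega
  have hsum : ∑ u : Kˣ, ∏ i, frobMod F K (v i) (g u * (u : K)⁻¹) ≠ 0 := by
    rw [sum_slopes_prod_frobMod hK ha, Finset.sum_eq_single v']
    · rw [if_pos (by rw [hshift]), mul_neg_one, neg_ne_zero, Finset.prod_ne_zero_iff]
      intro i _
      rw [Ne, frobMod_eq_zero]
      exact hstep i i.2
    · intro m _ hm
      split_ifs with h
      · refine mul_eq_zero_of_left ?_ _
        by_contra hne
        refine hm (funext fun i => ?_)
        obtain ⟨k, hk⟩ := mem_range_of_sum_pow_modEq hq m v hv h i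
        have hi := (frobMod_eq_zero (F := F) (v i)).not.1
          (Finset.prod_ne_zero_iff.1 hne i (Finset.mem_univ i))
        rw [← hk] at hi ⊢
        exact hchord i i.2 k k.2 hi
      · rw [mul_zero]
    · simp
  rw [sum_slopes_eq_of_range_eq hgs (fun y => ∏ i, frobMod F K (v i) y),
    sum_slopes_prod_frobMod (a := Pi.single s 1) hK
      (fun x => by simp [Pi.single_apply])] at hsum
  obtain ⟨m, -, hm⟩ := Finset.exists_ne_zero_of_sum_ne_zero hsum
  have hclosed : ∀ i, v i + s ∈ Set.range v := by
    intro i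
    have hmod := of_not_not fun h => hm (by rw [if_neg h, mul_zero])
    have hi := (frobMod_eq_zero (F := F) (v i)).not.1
      (Finset.prod_ne_zero_iff.1 (left_ne_zero_of_mul hm) i (Finset.mem_univ i))
    have his : m i - v i = s := by
      by_contra hne
      simp [hne] at hi
    rw [← his, add_sub_cancel]
    exact mem_range_of_sum_pow_modEq hq m v hv hmod i
  have hsurj : Function.Surjective v := by
    have : ∀ l : ℕ, l • s ∈ Set.range v := by
      intro l
      induction l with
      | zero => exact ⟨⟨0, hr⟩, by simp [v, hw0]⟩
      | succ l ih =>
        obtain ⟨i, hi⟩ := ih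
        rw [succ_nsmul, ← hi]
        exact hclosed i
    intro j
    obtain ⟨l, rfl⟩ := hs j
    exact this l
  have hrn : r = n := by
    simpa using Fintype.card_of_bijective ⟨hv, hsurj⟩
  have hunique : ∀ j, a j ≠ 0 → j = w 1 := by
    intro j hj
    obtain ⟨k, rfl⟩ := hsurj j
    exact hchord 0 hr k k.2 (by simpa [hw0] using hj)
  have hw1 : a (w 1) ≠ 0 := by simpa [hw0] using hstep 0 hr
  refine ⟨w 1, a (w 1), hw1, fun l hl h => hrn ▸ hmin _ hw1 l hl h, fun x => ?_⟩
  rw [ha, Finset.sum_eq_single (w 1)]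
  · intro j _ hj
    rw [of_not_not fun h => hj (hunique j h), zero_mul]
  · simp

end PowerSums

/-! ### Reduction to slopes -/

section Projective

variable {F K : Type*} [Field F] [Finite F] [Field K] [Algebra F K]

omit [Finite F] in
theorem mem_linearSetOf {f : K →ₗ[F] K} {P : ℙ K (K × K)} :
    P ∈ linearSetOf f ↔ ∃ (x : K) (hx : (x, f x) ≠ (0 : K × K)), P = Projectivization.mk K _ hx := by
  constructor
  · rintro ⟨⟨x, y⟩, hu, hmem, rfl⟩
    obtain rfl : y = f x := by simpa [LinearMap.mem_graph_iff] using hmem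
    exact ⟨x, hu, rfl⟩
  · rintro ⟨x, hx, rfl⟩
    exact ⟨_, hx, by simp [LinearMap.mem_graph_iff], rfl⟩

omit [Finite F] in
theorem fst_ne_zero {f : K →ₗ[F] K} {x : K} (hx : (x, f x) ≠ (0 : K × K)) : x ≠ 0 := by
  rintro rfl
  simp at hx

/-- In a semilinear equivalence the field automorphism can be absorbed, because applied to both
coordinates it preserves the points `⟨(z, z ^ (q ^ s))⟩`. What remains is the linear map with
columns `(p₁, p₂)` and `(q₁, q₂)`. -/
theorem exists_matrix_of_equivalent {s : ℕ} {f : K →ₗ[F] K}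
    (h : PGammaLEquivalent (linearSetOf (frobPow F K s)) (linearSetOf f)) :
    ∃ p₁ p₂ q₁ q₂ : K, p₁ * q₂ - p₂ * q₁ ≠ 0 ∧
      (∀ x, x ≠ 0 → ∃ z, z ≠ 0 ∧ ∃ l : K, x = l * (z * p₁ + frobPow F K s z * q₁) ∧
        f x = l * (z * p₂ + frobPow F K s z * q₂)) ∧
      (∀ z, z ≠ 0 → ∃ x, x ≠ 0 ∧ ∃ l : K, x = l * (z * p₁ + frobPow F K s z * q₁) ∧
        f x = l * (z * p₂ + frobPow F K s z * q₂)) := by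
  obtain ⟨σ, G, hG, himage⟩ := h
  have hGv : ∀ z z' : K, G (z, z') =
      (σ z * (G (1, 0)).1 + σ z' * (G (0, 1)).1, σ z * (G (1, 0)).2 + σ z' * (G (0, 1)).2) := by
    intro z z'
    have : (z, z') = z • ((1, 0) : K × K) + z' • ((0, 1) : K × K) := by simp
    rw [this, map_add, map_smulₛₗ, map_smulₛₗ]
    ext <;> simp
  have hσ : ∀ z, σ (frobPow F K s z) = frobPow F K s (σ z) := by
    intro z
    simp [frobPow_apply]
  refine ⟨(G (1, 0)).1, (G (1, 0)).2, (G (0, 1)).1, (G (0, 1)).2, ?_, ?_, ?_⟩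
  · intro hD
    have hker : ∀ z z' : K, G (z, z') = 0 → z = 0 ∧ z' = 0 := by
      intro z z' h0
      have := hG.injective (h0.trans (map_zero G).symm)
      simpa using this
    have h1 := hker (σ.symm (G (0, 1)).2) (σ.symm (-(G (1, 0)).2)) (by
      rw [hGv]
      ext
      · simp only [RingEquiv.apply_symm_apply, Prod.fst_zero]
        linear_combination hD
      · simp only [RingEquiv.apply_symm_apply, Prod.snd_zero]
        ring)
    have h2 := hker (σ.symm (G (0, 1)).1) (σ.symm (-(G (1, 0)).1)) (by
      rw [hGv]
      ext
      · simp only [RingEquiv.apply_symm_apply, Prod.fst_zero]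
        ring
      · simp only [RingEquiv.apply_symm_apply, Prod.snd_zero]
        linear_combination -hD)
    simp only [EmbeddingLike.map_eq_zero_iff, neg_eq_zero] at h1 h2
    have := hker 1 0 (Prod.ext h2.2 h1.2)
    exact one_ne_zero this.1
  · intro x hx
    have hxf : (x, f x) ≠ (0 : K × K) := fun h => hx (congrArg Prod.fst h)
    have hmem : Projectivization.mk K _ hxf ∈ linearSetOf f := mem_linearSetOf.2 ⟨x, hxf, rfl⟩
    rw [← himage] at hmem
    obtain ⟨P, hP, hPx⟩ := hmem
    obtain ⟨z, hz, rfl⟩ := mem_linearSetOf.1 hP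
    rw [Projectivization.map_mk, eq_comm, Projectivization.mk_eq_mk_iff'] at hPx
    obtain ⟨l, hl⟩ := hPx
    rw [hGv, hσ] at hl
    refine ⟨σ z, (map_ne_zero σ).2 (fst_ne_zero hz), l, ?_, ?_⟩
    · simpa using (congrArg Prod.fst hl).symm
    · simpa using (congrArg Prod.snd hl).symm
  · intro z hz
    have hz0 : (σ.symm z, frobPow F K s (σ.symm z)) ≠ (0 : K × K) := fun h =>
      hz (by simpa using congrArg Prod.fst h)
    have hmem := Set.mem_image_of_mem (Projectivization.map G hG.injective)
      (mem_linearSetOf.2 ⟨_, hz0, rfl⟩ :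
        Projectivization.mk K _ hz0 ∈ linearSetOf (frobPow F K s))
    rw [himage] at hmem
    obtain ⟨x, hx, hPx⟩ := mem_linearSetOf.1 hmem
    rw [Projectivization.map_mk, eq_comm, Projectivization.mk_eq_mk_iff'] at hPx
    obtain ⟨l, hl⟩ := hPx
    rw [hGv, hσ, RingEquiv.apply_symm_apply] at hl
    refine ⟨x, fst_ne_zero hx, l, ?_, ?_⟩
    · simpa using (congrArg Prod.fst hl).symm
    · simpa using (congrArg Prod.snd hl).symm

/-- If `L_f` is of pseudoregulus type, then a change of coordinates carries the graph of `f` to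
that of a monomial `x ↦ c * x ^ (q ^ i)` with `i` of order `n`. -/
theorem exists_monomial_relation {n : ℕ} [NeZero n] (hK : Module.finrank F K = n)
    (hq : 3 ≤ Nat.card F) {f : K →ₗ[F] K} (h : IsPseudoregulusType F (linearSetOf f)) :
    ∃ (p₁ p₂ q₁ q₂ c : K) (i : ZMod n), p₁ * q₂ - p₂ * q₁ ≠ 0 ∧ c ≠ 0 ∧
      (∀ l, 0 < l → l • i = 0 → n ≤ l) ∧
      ∀ x, p₁ * f x - p₂ * x = c * frobMod F K i (q₂ * x - q₁ * f x) := by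
  obtain ⟨s, -, -, hsn, heq⟩ := h
  rw [hK] at hsn
  obtain ⟨p₁, p₂, q₁, q₂, hD, hx, hz⟩ := exists_matrix_of_equivalent heq
  have : FiniteDimensional F K := FiniteDimensional.of_finrank_pos (hK ▸ Nat.pos_of_neZero n)
  let h₁ : K →ₗ[F] K := LinearMap.mulLeft F q₂ - LinearMap.mulLeft F q₁ ∘ₗ f
  let h₂ : K →ₗ[F] K := LinearMap.mulLeft F p₁ ∘ₗ f - LinearMap.mulLeft F p₂
  have hh₁ : ∀ x, h₁ x = q₂ * x - q₁ * f x := fun x => by simp [h₁]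
  have hh₂ : ∀ x, h₂ x = p₁ * f x - p₂ * x := fun x => by simp [h₂]
  -- Cramer's rule for the coordinates of `(x, f x)` in the basis `(p₁, p₂), (q₁, q₂)`.
  have hsol : ∀ {x z l : K}, x = l * (z * p₁ + frobPow F K s z * q₁) →
      f x = l * (z * p₂ + frobPow F K s z * q₂) →
      h₁ x = l * z * (p₁ * q₂ - p₂ * q₁) ∧
      h₂ x = l * frobPow F K s z * (p₁ * q₂ - p₂ * q₁) := by
    intro x z l e₁ e₂
    rw [hh₁, hh₂]
    constructor
    · linear_combination q₂ * e₁ - q₁ * e₂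
    · linear_combination p₁ * e₂ - p₂ * e₁
  have hne : ∀ {x z l : K}, x ≠ 0 → z ≠ 0 → x = l * (z * p₁ + frobPow F K s z * q₁) →
      f x = l * (z * p₂ + frobPow F K s z * q₂) →
      h₁ x ≠ 0 ∧ h₂ x * (h₁ x)⁻¹ = frobPow F K s z * z⁻¹ := by
    intro x z l hx hz e₁ e₂
    have hl : l ≠ 0 := by
      rintro rfl
      exact hx (by rw [e₁, zero_mul])
    obtain ⟨r₁, r₂⟩ := hsol e₁ e₂
    have h0 : h₁ x ≠ 0 := by
      rw [r₁]
      exact mul_ne_zero (mul_ne_zero hl hz) hD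
    refine ⟨h0, ?_⟩
    rw [r₁, r₂]
    field_simp
  have hinj : Function.Injective h₁ := by
    rw [injective_iff_map_eq_zero]
    intro x hx0
    by_contra hxne
    obtain ⟨z, hz0, l, e₁, e₂⟩ := hx x hxne
    exact (hne hxne hz0 e₁ e₂).1 hx0
  let e : K ≃ₗ[F] K := LinearEquiv.ofInjectiveEndo h₁ hinj
  have he : ∀ x, e x = h₁ x := fun x => rfl
  have hslopes : Set.range (fun u : Kˣ => (h₂ ∘ₗ e.symm.toLinearMap) u * (u : K)⁻¹) =
      Set.range fun u : Kˣ => frobMod F K (s : ZMod n) u * (u : K)⁻¹ := by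
    ext y
    simp only [Set.mem_range, LinearMap.comp_apply, LinearEquiv.coe_coe, frobMod_natCast hK]
    constructor
    · rintro ⟨u, rfl⟩
      have hxne : e.symm u ≠ 0 := by simp
      obtain ⟨z, hz0, l, e₁, e₂⟩ := hx _ hxne
      refine ⟨Units.mk0 z hz0, ?_⟩
      have := (hne hxne hz0 e₁ e₂).2
      rw [← he, LinearEquiv.apply_symm_apply] at this
      rw [this]
      rfl
    · rintro ⟨u, rfl⟩
      obtain ⟨x, hx0, l, e₁, e₂⟩ := hz u u.ne_zero
      obtain ⟨h0, h1⟩ := hne hx0 u.ne_zero e₁ e₂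
      refine ⟨Units.mk0 _ h0, ?_⟩
      rw [Units.val_mk0, ← he, LinearEquiv.symm_apply_apply, he, h1]
      rfl
  obtain ⟨i, c, hc, hi, hg⟩ := exists_eq_mul_frobMod_of_slopes hK hq (s := (s : ZMod n))
    (fun j => ⟨(j * (s : ZMod n)⁻¹).val, by
      rw [nsmul_eq_mul, ZMod.natCast_zmod_val, mul_assoc, mul_comm _ (s : ZMod n),
        ZMod.coe_mul_inv_eq_one s hsn, mul_one]⟩) hslopes
  refine ⟨p₁, p₂, q₁, q₂, c, i, hD, hc, hi, fun x => ?_⟩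
  have := hg (e x)
  rw [LinearMap.comp_apply, LinearEquiv.coe_coe, LinearEquiv.symm_apply_apply, he, hh₁, hh₂] at this
  exact this

end Projective

/-! ### Comparison of coefficients -/

theorem exists_nsmul_eq_of_order {n : ℕ} [NeZero n] {i : ZMod n}
    (hi : ∀ l, 0 < l → l • i = 0 → n ≤ l) (j : ZMod n) : ∃ l < n, l • i = j := by
  have hinj : Function.Injective fun l : Fin n => (l : ℕ) • i := by
    have aux : ∀ a b : Fin n, a < b → (a : ℕ) • i ≠ (b : ℕ) • i := by
      intro a b hab h
      have h0 : ((b : ℕ) - a) • i = 0 := by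
        rw [sub_nsmul _ hab.le, h, add_neg_cancel]
      have := hi _ (Nat.sub_pos_of_lt hab) h0
      omega
    intro a b h
    rcases lt_trichotomy a b with hab | hab | hab
    · exact absurd h (aux a b hab)
    · exact hab
    · exact absurd h.symm (aux b a hab)
  obtain ⟨l, hl⟩ := ((Fintype.bijective_iff_injective_and_card _).2 ⟨hinj, by simp⟩).2 j
  exact ⟨l, l.2, hl⟩

section Coefficients

variable {F K : Type*} [Field F] [Finite F] [Field K] [Algebra F K]

/-- Let `f` have zero constant coefficient and support invariant under translation by `t ≠ 0`.
The monomial relation links the coefficients of `f` at `j` and `j - i` for all `j ≠ 0, i`. If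
`p₁, q₁ ≠ 0`, they therefore vanish at all nonzero exponents or at none, and the one at `t` vanishes
with the one at `0`. If `q₁ = 0` or `p₁ = 0`, then `f` has at most one exponent, `i` or `-i`. -/
theorem coeff_eq_zero_of_monomial_relation {n : ℕ} [NeZero n] (hK : Module.finrank F K = n)
    {f : K →ₗ[F] K} {b : ZMod n → K} (hf : ∀ x, f x = ∑ j, b j * frobMod F K j x)
    {t : ZMod n} (ht : t ≠ 0) (hb0 : b 0 = 0) (hbt : ∀ j, b (j + t) = 0 ↔ b j = 0)
    {p₁ p₂ q₁ q₂ c : K} {i : ZMod n} (hD : p₁ * q₂ - p₂ * q₁ ≠ 0) (hc : c ≠ 0)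
    (hi : ∀ l, 0 < l → l • i = 0 → n ≤ l)
    (h : ∀ x, p₁ * f x - p₂ * x = c * frobMod F K i (q₂ * x - q₁ * f x)) :
    ∀ j, b j = 0 := by
  have hcoeff : ∀ j, p₁ * b j - (if j = 0 then p₂ else 0) =
      c * ((if j = i then frobMod F K i q₂ else 0) -
        frobMod F K i q₁ * frobMod F K i (b (j - i))) := by
    refine congrFun (eq_of_frobMod_expansion (F := F) hK fun x => ?_)
    have h1 : ∑ j, (p₁ * b j - (if j = 0 then p₂ else 0)) * frobMod F K j x =
        p₁ * f x - p₂ * x := by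
      simp [sub_mul, Finset.sum_sub_distrib, hf, Finset.mul_sum, mul_assoc, frobMod_zero]
    have h2 : frobMod F K i (f x) =
        ∑ j, frobMod F K i (b (j - i)) * frobMod F K j x := by
      rw [hf, map_sum, ← Equiv.sum_comp (Equiv.subRight i)]
      refine Finset.sum_congr rfl fun m _ => ?_
      rw [frobMod_mul, ← frobMod_add hK, Equiv.subRight_apply, add_sub_cancel]
    rw [h1, h, map_sub, frobMod_mul, frobMod_mul, h2]
    simp [sub_mul, mul_sub, Finset.sum_sub_distrib, Finset.mul_sum, mul_assoc]
  have hlink : ∀ j, j ≠ 0 → j ≠ i →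
      p₁ * b j = -(c * (frobMod F K i q₁ * frobMod F K i (b (j - i)))) := by
    intro j hj hji
    have := hcoeff j
    rw [if_neg hj, if_neg hji] at this
    linear_combination this
  by_cases hq₁ : q₁ = 0
  · have hp₁ : p₁ ≠ 0 := by
      rintro rfl
      simp [hq₁] at hD
    have hzero : ∀ j, j ≠ i → b j = 0 := by
      intro j hji
      rcases eq_or_ne j 0 with rfl | hj
      · exact hb0
      · simpa [hq₁, hp₁] using hlink j hj hji
    intro j
    rcases eq_or_ne j i with rfl | hji
    · exact (hbt j).1 (hzero _ (by simpa using ht))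
    · exact hzero j hji
  · have hq₁' : frobMod F K i q₁ ≠ 0 := (frobMod_eq_zero i).not.2 hq₁
    by_cases hp₁ : p₁ = 0
    · have hzero : ∀ j, j ≠ -i → b j = 0 := by
        intro j hji
        rcases eq_or_ne j 0 with rfl | hj
        · exact hb0
        · have := hlink (j + i) (fun h => hji (eq_neg_of_add_eq_zero_left h)) (by simpa using hj)
          simpa [hp₁, hc, hq₁', frobMod_eq_zero] using this
      intro j
      rcases eq_or_ne j (-i) with rfl | hji
      · exact (hbt _).1 (hzero _ (by simpa using ht))
      · exact hzero j hji
    · have hiff : ∀ j, j ≠ 0 → j ≠ i → (b j = 0 ↔ b (j - i) = 0) := by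
        intro j hj hji
        have := hlink j hj hji
        constructor
        · intro h0
          simpa [h0, hc, hq₁', frobMod_eq_zero] using this
        · intro h0
          simpa [h0, hp₁] using this
      have hchain : ∀ l, l + 1 < n → (b ((l + 1) • i) = 0 ↔ b i = 0) := by
        intro l
        induction l with
        | zero => simp
        | succ l ih =>
          intro hl
          rw [← ih (by omega), hiff]
          · rw [succ_nsmul, add_sub_cancel_right]
          · intro h0
            have := hi _ (by omega) h0
            omega
          · intro h0
            rw [succ_nsmul, add_eq_right] at h0
            have := hi _ (by omega) h0
            omega
      have hall : ∀ j, j ≠ 0 → (b j = 0 ↔ b i = 0) := by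
        intro j hj
        obtain ⟨l, hl, rfl⟩ := exists_nsmul_eq_of_order hi j
        obtain _ | l := l
        · simp at hj
        · exact hchain l hl
      have hbi : b i = 0 := (hall t ht).1 (by simpa using (hbt 0).2 hb0)
      intro j
      rcases eq_or_ne j 0 with rfl | hj
      · exact hb0
      · exact (hall j hj).2 hbi

/-! ### The iterates of `ψ` -/

/-- On the eigenspaces of `x ↦ x ^ (q ^ t)` for `1` and `-1`, the map `ψ` is `x ↦ x ^ (q ^ (-1))`
and `x ↦ x ^ q`. -/
theorem psiPoly_pow_apply {t : ℕ} [NeZero (2 * t)] (ht : 1 ≤ t)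
    (hK : Module.finrank F K = 2 * t) (h2 : (2 : F) ≠ 0) (k : ℕ) (x : K) :
    (psiPoly F K t ^ k) x = (2 : F)⁻¹ •
      (frobMod F K (-(k : ZMod (2 * t))) (x + frobMod F K (t : ZMod (2 * t)) x) +
        frobMod F K (k : ZMod (2 * t)) (x - frobMod F K (t : ZMod (2 * t)) x)) := by
  have htt : (t : ZMod (2 * t)) + t = 0 := by
    rw [← Nat.cast_add, ← two_mul, ZMod.natCast_self]
  have hττ : ∀ y : K, frobMod F K (t : ZMod (2 * t)) (frobMod F K (t : ZMod (2 * t)) y) = y := by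
    intro y
    rw [← frobMod_add hK, htt, frobMod_zero]
  have hcomm : ∀ (j : ZMod (2 * t)) (y : K), frobMod F K (t : ZMod (2 * t)) (frobMod F K j y) =
      frobMod F K j (frobMod F K (t : ZMod (2 * t)) y) := by
    intro j y
    rw [← frobMod_add hK, add_comm, frobMod_add hK]
  have htwo : ∀ y : K, (2 : F)⁻¹ • (y + y) = y := by
    intro y
    rw [← two_smul F y, smul_smul, inv_mul_cancel₀ h2, one_smul]
  have hψ : ∀ y : K, psiPoly F K t y = (2 : F)⁻¹ •
      (frobMod F K (-1 : ZMod (2 * t)) (y + frobMod F K (t : ZMod (2 * t)) y) +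
        frobMod F K (1 : ZMod (2 * t)) (y - frobMod F K (t : ZMod (2 * t)) y)) := by
    intro y
    have h1 : (-1 : ZMod (2 * t)) + t = ((t - 1 : ℕ) : ZMod (2 * t)) := by
      rw [Nat.cast_sub ht, Nat.cast_one]
      ring
    have h3 : frobMod F K (-1 : ZMod (2 * t)) (y + frobMod F K (t : ZMod (2 * t)) y) =
        (y + frobMod F K (t : ZMod (2 * t)) y) ^ Nat.card F ^ (t - 1) := by
      rw [← frobMod_natCast hK, ← h1, frobMod_add hK, map_add (frobMod F K (t : ZMod (2 * t))), hττ,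
        add_comm y]
    have h4 := frobMod_natCast hK 1 (y - frobMod F K (t : ZMod (2 * t)) y)
    rw [Nat.cast_one] at h4
    rw [h3, h4, frobMod_natCast hK]
    simp [psiPoly, alphaPoly, betaPoly, frobPow_apply]
  induction k with
  | zero =>
    rw [pow_zero, Module.End.one_apply, Nat.cast_zero, neg_zero, frobMod_zero, frobMod_zero]
    rw [show x + frobMod F K (t : ZMod (2 * t)) x + (x - frobMod F K (t : ZMod (2 * t)) x) = x + x
      by ring, htwo]
  | succ k ih =>
    set τ := frobMod F K (t : ZMod (2 * t))
    have hplus : (psiPoly F K t ^ k) x + τ ((psiPoly F K t ^ k) x) =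
        frobMod F K (-(k : ZMod (2 * t))) (x + τ x) := by
      conv_rhs => rw [← htwo (frobMod F K (-(k : ZMod (2 * t))) (x + τ x))]
      simp only [ih, map_smul, map_add, map_sub, hcomm, hττ, ← smul_add]
      congr 1
      ring
    have hminus : (psiPoly F K t ^ k) x - τ ((psiPoly F K t ^ k) x) =
        frobMod F K (k : ZMod (2 * t)) (x - τ x) := by
      conv_rhs => rw [← htwo (frobMod F K (k : ZMod (2 * t)) (x - τ x))]
      simp only [ih, map_smul, map_add, map_sub, hcomm, hττ, ← smul_sub]
      congr 1
      ring
    rw [pow_succ', Module.End.mul_apply, hψ, hplus, hminus, ← frobMod_add hK, ← frobMod_add hK,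
      Nat.cast_succ, neg_add, add_comm (-1 : ZMod (2 * t)), add_comm (1 : ZMod (2 * t))]

end Coefficients

/-! ### The linear set of `ψ ^ k` -/

/-- `ψ ^ k` is the `k`-fold composition of `ψ`; `q = |F|` and `n = [K : F] = 2 * t`. -/
theorem proposition3p3 {F K : Type*} [Field F] [Finite F] [Field K] [Algebra F K]
    (hq : Odd (Nat.card F)) (n t : ℕ) (hnt : n = 2 * t) (hn : 6 ≤ n)
    (hK : Module.finrank F K = n) (k : ℕ) (hk : Nat.gcd n k = 1) :
    ¬ IsPseudoregulusType F (linearSetOf (psiPoly F K t ^ k)) := by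
  subst hnt
  have : NeZero (2 * t) := ⟨by omega⟩
  have := Fintype.ofFinite F
  have hq3 : 3 ≤ Nat.card F := by
    have h1 : 1 < Nat.card F := Finite.one_lt_card
    obtain ⟨m, hm⟩ := hq
    omega
  have h2 : (2 : F) ≠ 0 := by
    intro h
    have hchar : CharP F 2 := CharTwo.of_one_ne_zero_of_two_eq_zero one_ne_zero h
    have := FiniteField.even_card_of_char_two (F := F) (ringChar.eq F 2 ▸ rfl)
    obtain ⟨m, hm⟩ := hq
    rw [Nat.card_eq_fintype_card] at hm
    omega
  have h2K : (2 : K) ≠ 0 := by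
    rw [← map_ofNat (algebraMap F K) 2]
    exact (map_ne_zero _).2 h2
  have hdvd : ¬ t ∣ 2 * k := by
    intro h
    have hcop : Nat.Coprime t k := Nat.Coprime.coprime_dvd_left (Dvd.intro_left 2 rfl) hk
    have := Nat.le_of_dvd (by norm_num) (hcop.dvd_of_dvd_mul_right h)
    omega
  have hcast : ∀ m : ℕ, (m : ZMod (2 * t)) = 0 → t ∣ m := fun m hm =>
    (Dvd.intro_left 2 rfl).trans ((ZMod.natCast_eq_zero_iff m (2 * t)).1 hm)
  have htt : (t : ZMod (2 * t)) + t = 0 := by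
    rw [← Nat.cast_add, ← two_mul, ZMod.natCast_self]
  have ht0 : (t : ZMod (2 * t)) ≠ 0 := by
    intro h
    have := Nat.le_of_dvd (by omega) ((ZMod.natCast_eq_zero_iff t (2 * t)).1 h)
    omega
  have hkk : (k : ZMod (2 * t)) + k ≠ 0 := by
    intro h
    refine hdvd (hcast _ ?_)
    push_cast
    rw [two_mul (k : ZMod (2 * t)), h]
  have hkkt : (k : ZMod (2 * t)) + k ≠ t := by
    intro h
    refine hdvd ((Nat.dvd_add_left (dvd_refl t)).1 (hcast (2 * k + t) ?_))
    push_cast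
    rw [two_mul (k : ZMod (2 * t)), h, htt]
  intro hps
  obtain ⟨p₁, p₂, q₁, q₂, c, i, hD, hc, hi, hrel⟩ := exists_monomial_relation hK hq3 hps
  have hψ := psiPoly_pow_apply (by omega) hK h2 k
  generalize (t : ZMod (2 * t)) = τ at *
  generalize (k : ZMod (2 * t)) = κ at *
  let b : ZMod (2 * t) → K := fun j => (2 : K)⁻¹ *
    ((if j = -κ then 1 else 0) + (if j = -κ + τ then 1 else 0) +
      ((if j = κ then 1 else 0) - if j = κ + τ then 1 else 0))
  have hf : ∀ x, (psiPoly F K t ^ k) x = ∑ j, b j * frobMod F K j x := by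
    intro x
    have h2FK : algebraMap F K 2 = 2 := map_ofNat _ 2
    simp [hψ, h2FK, b, mul_assoc, add_mul, sub_mul, ← Finset.mul_sum, Finset.sum_add_distrib,
      Finset.sum_sub_distrib, frobMod_add hK, Algebra.smul_def]
  have hneg : -τ = τ := neg_eq_of_add_eq_zero_left htt
  -- This is where `2 * k` must not be divisible by `t`: otherwise terms of `ψ ^ k` could cancel.
  have hdisj : ∀ j, j = κ ∨ j = κ + τ → j ≠ -κ ∧ j ≠ -κ + τ := by
    rintro j (rfl | rfl)
    · exact ⟨fun h => hkk (by linear_combination h), fun h => hkkt (by linear_combination h)⟩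
    · exact ⟨fun h => hkkt (by linear_combination h - htt), fun h => hkk (by linear_combination h)⟩
  have hb0 : b 0 = 0 := by
    have h1 : κ ≠ 0 := by
      rintro rfl
      simp at hkk
    have h2 : κ ≠ -τ := by
      intro h
      rw [hneg] at h
      exact hkk (h ▸ htt)
    have h3 : -κ + τ ≠ 0 := fun h => h2 (by rw [hneg]; linear_combination -h)
    have h4 : κ + τ ≠ 0 := fun h => h2 (by linear_combination h)
    simp [b, h1, h1.symm, h3.symm, h4.symm]
  have hbt : ∀ j, b (j + τ) = 0 ↔ b j = 0 := by
    intro j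
    have hswap : ∀ a, j + τ = a ↔ j = a + τ := fun a =>
      ⟨fun h => by linear_combination h - htt, fun h => by linear_combination h + htt⟩
    by_cases hj : j = κ ∨ j = κ + τ
    · obtain ⟨h1, h2⟩ := hdisj j hj
      simp only [b, hswap, add_assoc, htt, add_zero, if_neg h1, if_neg h2, zero_add,
        mul_eq_zero, inv_eq_zero, h2K, false_or, sub_eq_zero]
      exact eq_comm
    · obtain ⟨h1, h2⟩ := not_or.1 hj
      simp only [b, hswap, add_assoc, htt, add_zero, if_neg h1, if_neg h2, sub_zero]
      rw [add_comm]
  have hbκ : b κ = 0 :=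
    coeff_eq_zero_of_monomial_relation hK hf ht0 hb0 hbt hD hc hi hrel κ
  obtain ⟨h1, h3⟩ := hdisj κ (Or.inl rfl)
  simp [b, h1, h3, ht0, h2K] at hbκ
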